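/- Fix a real number $\varepsilon>0$. Then there is an integer $N=N(\varepsilon)$ such that for every integer $n\ge N$ and every positive integer $b\le\left(\frac12-\varepsilon\right)n$, Maker has a winning strategy in the $(1:b)$ Maker–Breaker non-planarity game on $E(K_n)$. Here the board is the edge set $E(K_n)$ of the complete graph on $n$ vertices. Two players, Maker and Breaker, alternately claim previously unclaimed edges, with Maker moving first; Maker claims exactly $1$ edge and Breaker exactly $b$ edges per turn (a player facing fewer unclaimed edges than that claims all of them). The game ends when all edges have been claimed, and Maker wins if and only if the graph formed by his edges is non-planar, i.e. contains all the edges of some non-planar graph on the same $n$ vertices. A graph is planar if it can be drawn in the Euclidean plane with distinct vertices as distinct points and edges as simple continuous arcs joining their end-vertices, such that the interior of an edge contains no vertex and the interiors of distinct edges are disjoint. -/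

import Mathlib

/-! ### Biased Maker-Breaker games -/

/-- A legal turn of a player with bias `q`: when `M` and `B` are the sets already claimed by Maker
and Breaker, the player claims a set `C` of exactly `q` free elements of the board, or all the
remaining free elements if fewer than `q` are left. -/
def IsLegalClaim {α : Type*} [DecidableEq α] (board : Finset α) (q : ℕ) (M B C : Finset α) : Prop :=
  C ⊆ board \ (M ∪ B) ∧ C.card = min q (board \ (M ∪ B)).card

/-- `MakerWinsFrom board H m b M B`: in the biased `(m : b)` Maker-Breaker game on the hypergraph
`(board, H)`, Maker has a winning strategy from the position in which Maker has claimed `M`,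
Breaker has claimed `B`, and it is Maker's turn. A final position (no free element left) is won by
Maker if he has fully occupied a winning set `A ∈ H`; any other position is won by him if he has a
legal turn `C` such that he wins after every legal answer `D` of Breaker. -/
inductive MakerWinsFrom {α : Type*} [DecidableEq α] (board : Finset α) (H : Set (Finset α))
    (m b : ℕ) : Finset α → Finset α → Prop
  | final (M B : Finset α) (hfull : board \ (M ∪ B) = ∅) (hwin : ∃ A ∈ H, A ⊆ M) :
      MakerWinsFrom board H m b M B
  | turn (M B C : Finset α) (hfree : (board \ (M ∪ B)).Nonempty)
      (hC : IsLegalClaim board m M B C)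
      (hD : ∀ D, IsLegalClaim board b (M ∪ C) B D →
        MakerWinsFrom board H m b (M ∪ C) (B ∪ D)) :
      MakerWinsFrom board H m b M B

/-- Maker wins the biased `(m : b)` Maker-Breaker game on `(board, H)`, moving first. -/
def MakerWins {α : Type*} [DecidableEq α] (board : Finset α) (H : Set (Finset α))
    (m b : ℕ) : Prop :=
  MakerWinsFrom board H m b ∅ ∅

/-! ### Planar graphs -/

/-- A drawing of `G` in the Euclidean plane without crossings: distinct vertices are distinct
points, every edge is a simple arc joining its two end-vertices, the interior of an edge contains
no vertex, and the interiors of distinct edges are disjoint. -/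
structure PlaneDrawing {V : Type*} (G : SimpleGraph V) where
  point : V → EuclideanSpace ℝ (Fin 2)
  arc : G.edgeSet → C(unitInterval, EuclideanSpace ℝ (Fin 2))
  point_injective : Function.Injective point
  arc_injective : ∀ e, Function.Injective (arc e)
  arc_ends : ∀ e : G.edgeSet, s(arc e 0, arc e 1) = Sym2.map point (e : Sym2 V)
  arc_ne_point : ∀ e, ∀ t ∈ Set.Ioo (0 : unitInterval) 1, ∀ v, arc e t ≠ point v
  arc_ne_arc : ∀ e f, e ≠ f → ∀ s ∈ Set.Ioo (0 : unitInterval) 1,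
    ∀ t ∈ Set.Ioo (0 : unitInterval) 1, arc e s ≠ arc f t

/-- A graph is planar if it can be drawn in the plane without crossings. -/
def IsPlanar {V : Type*} (G : SimpleGraph V) : Prop := Nonempty (PlaneDrawing G)

/-! ### The non-planarity game -/

/-- The board `E(K_n)`, where `K_n` is the complete graph on the vertex set `Fin n`. -/
def completeBoard (n : ℕ) : Finset (Sym2 (Fin n)) := (⊤ : SimpleGraph (Fin n)).edgeFinset

/-- The winning sets of the non-planarity game on `E(K_n)`: the edge sets of the non-planar graphs
on the vertex set `Fin n`. -/
def nonPlanarSets (n : ℕ) : Set (Finset (Sym2 (Fin n))) :=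
  {A | A ⊆ completeBoard n ∧
    ¬ IsPlanar (SimpleGraph.fromEdgeSet (A : Set (Sym2 (Fin n))))}

/-!
Maker always claims an edge between two low-degree vertices that are far apart in his graph. A graph
with `m` edges and bounded degree forbids few pairs of vertices, so as long as `m ≤ (1 + ε) n` the
`m (b + 1)` claimed edges leave such a pair free. In the end Maker has `(1 + ε) n` edges and no
short cycle.

Such a graph is not planar. Cutting a breadth-first forest of it at every `r`-th level, with the
offset chosen by averaging, and contracting the pieces loses at most `n` edges, because the large
girth prevents the remaining edges from collapsing or coinciding. At most `2 n / r` vertices of the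
contracted graph are not isolated, but about `ε n` edges survive, so Mader's argument (contract
edges with few common neighbours, then pass to a neighbourhood) finds a `K₅` minor.

In a plane drawing a `K₅` minor would yield five disjoint sets in `ℂ`, any two of which have a
path-connected union, and hence five points with paths `γ i j` joining them. For disjoint pairs
`ij`, `kl` the map `(s, t) ↦ γ i j s - γ k l t` has no zeros on the square, so the changes of its
argument along the four sides cancel; modulo `2` these relations are inconsistent.
-/

section ContinuousLogarithm

open Complex

theorem exists_continuous_log {X : Type*} [TopologicalSpace X] [LocallyPathConnectedSpace X]
    [SimplyConnectedSpace X] {g : X → ℂ} (hg : Continuous g) (h0 : ∀ x, g x ≠ 0) :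
    ∃ L : X → ℂ, Continuous L ∧ ∀ x, exp (L x) = g x := by
  obtain ⟨x₀⟩ : Nonempty X := inferInstance
  obtain ⟨L, ⟨-, hL⟩, -⟩ := isCoveringMapOn_exp.existsUnique_continuousMap_lifts
    (⟨g, hg⟩ : C(X, ℂ)) (exp_log (h0 x₀)) h0
  exact ⟨L, L.continuous, fun x => congrFun hL x⟩

theorem sub_eq_sub_of_exp_eq {X : Type*} [TopologicalSpace X] [PreconnectedSpace X] {f g : X → ℂ}
    (hf : Continuous f) (hg : Continuous g) (h : ∀ x, exp (f x) = exp (g x)) (x y : X) :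
    f x - f y = g x - g y := by
  choose n hn using fun x => exp_eq_exp_iff_exists_int.mp (h x)
  have hn_re : ∀ x, (n x : ℝ) = ((f x - g x) / (2 * Real.pi * I)).re := fun x => by
    rw [hn, add_sub_cancel_left, mul_div_assoc, div_self two_pi_I_ne_zero, mul_one, intCast_re]
  have hn_cont : Continuous n := by
    refine Int.isClosedEmbedding_coe_real.isEmbedding.continuous_iff.mpr ?_
    simp only [Function.comp_def, hn_re]
    fun_prop
  rw [hn x, hn y, PreconnectedSpace.constant inferInstance hn_cont (x := x) (y := y)]
  ring

open Classical in
/-- The change `L 1 - L 0` of a continuous logarithm `L` of `g` over the unit interval; its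
imaginary part is the change of the argument of `g`. The junk value is `0` if `g` has no such
logarithm. -/
noncomputable def logChange (g : ℝ → ℂ) : ℂ :=
  if h : ∃ L : ℝ → ℂ, Continuous L ∧ ∀ t, exp (L t) = g t then h.choose 1 - h.choose 0 else 0

theorem logChange_eq_sub {g L : ℝ → ℂ} (hL : Continuous L) (hLg : ∀ t, exp (L t) = g t) :
    logChange g = L 1 - L 0 := by
  have h : ∃ L : ℝ → ℂ, Continuous L ∧ ∀ t, exp (L t) = g t := ⟨L, hL, hLg⟩
  rw [logChange, dif_pos h]
  exact sub_eq_sub_of_exp_eq h.choose_spec.1 hL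
    (fun t => (h.choose_spec.2 t).trans (hLg t).symm) 1 0

theorem logChange_neg {g : ℝ → ℂ} (hg : Continuous g) (h0 : ∀ t, g t ≠ 0) :
    logChange (fun t => -g t) = logChange g := by
  obtain ⟨L, hL, hLg⟩ := exists_continuous_log hg h0
  rw [logChange_eq_sub hL hLg, logChange_eq_sub (L := fun t => L t + Real.pi * I) (by fun_prop)
    fun t => by rw [exp_add, exp_pi_mul_I, hLg, mul_neg_one]]
  ring

theorem exists_int_logChange_eq {g : ℝ → ℂ} (hg : Continuous g) (h0 : ∀ t, g t ≠ 0) {z w : ℂ}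
    (hz : exp z = g 0) (hw : exp w = g 1) :
    ∃ n : ℤ, logChange g = w - z + n * (2 * Real.pi * I) := by
  obtain ⟨L, hL, hLg⟩ := exists_continuous_log hg h0
  obtain ⟨k, hk⟩ := exp_eq_exp_iff_exists_int.mp ((hLg 0).trans hz.symm)
  obtain ⟨m, hm⟩ := exp_eq_exp_iff_exists_int.mp ((hLg 1).trans hw.symm)
  refine ⟨m - k, ?_⟩
  rw [logChange_eq_sub hL hLg, hk, hm]
  push_cast
  ring

theorem logChange_square {g : ℝ → ℝ → ℂ} (hg : Continuous fun x : ℝ × ℝ => g x.1 x.2)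
    (h0 : ∀ s t, g s t ≠ 0) :
    logChange (g 0) + logChange (fun s => g s 1) =
      logChange (fun s => g s 0) + logChange (g 1) := by
  obtain ⟨L, hL, hLg⟩ := exists_continuous_log hg fun x => h0 x.1 x.2
  rw [logChange_eq_sub (L := fun t => L (0, t)) (by fun_prop) fun t => hLg (0, t),
    logChange_eq_sub (L := fun t => L (1, t)) (by fun_prop) fun t => hLg (1, t),
    logChange_eq_sub (L := fun s => L (s, 0)) (by fun_prop) fun s => hLg (s, 0),
    logChange_eq_sub (L := fun s => L (s, 1)) (by fun_prop) fun s => hLg (s, 1)]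
  ring

theorem logChange_sub_square {a b : ℝ → ℂ} (ha : Continuous a) (hb : Continuous b)
    (hab : ∀ s t, a s ≠ b t) :
    logChange (fun t => a 0 - b t) + logChange (fun s => b 1 - a s) =
      logChange (fun s => b 0 - a s) + logChange (fun t => a 1 - b t) := by
  have hswap : ∀ t, logChange (fun s => b t - a s) = logChange fun s => a s - b t := fun t => by
    simpa only [neg_sub] using
      logChange_neg (g := fun s => a s - b t) (by fun_prop) fun s => sub_ne_zero.mpr (hab s t)
  rw [hswap, hswap]
  exact logChange_square (g := fun s t => a s - b t) (by fun_prop) fun s t =>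
    sub_ne_zero.mpr (hab s t)

end ContinuousLogarithm

section DrawingFive

open Complex

/-- The sign comparing two indices, extended by `-1` to the diagonal. In a convex polygon the sum of
the four signs around the quadrilateral `i l j k` is `±2` if the diagonals `ij` and `kl` cross, and
`0` otherwise. -/
def orderSign {ι : Type*} [LT ι] [DecidableLT ι] (i j : ι) : ℤ := if i < j then 1 else -1

theorem exists_log_sub {ι : Type*} [LinearOrder ι] {p : ι → ℂ} (hp : Function.Injective p) :
    ∃ φ : ι → ι → ℂ, ∀ i j, i ≠ j → exp (φ i j) = p i - p j ∧
      φ i j - φ j i = orderSign i j * (Real.pi * I) := by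
  refine ⟨fun i j => if i < j then log (p j - p i) + Real.pi * I else log (p i - p j),
    fun i j hij => ?_⟩
  have hexp : ∀ {i j}, i ≠ j → exp (log (p i - p j)) = p i - p j := fun hij =>
    exp_log (sub_ne_zero.mpr (hp.ne hij))
  rcases lt_or_gt_of_ne hij with h | h
  · simp [h, h.not_gt, orderSign, exp_add, hexp hij.symm]
  · simp [h, h.not_gt, orderSign, hexp hij]

/-- Modulo `2`, the identity for `ij`, `kl` says that the sum of the four integers `n` is odd if and
only if the diagonals `ij` and `kl` of a convex pentagon cross. There are five such crossings, but
each `n k i j` occurs in two of the fifteen identities. -/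
theorem false_of_crossing_identities (n : Fin 5 → Fin 5 → Fin 5 → ℤ)
    (h : ∀ i j k l, i < j → k < l → i ≠ k → i ≠ l → j ≠ k → j ≠ l →
      orderSign i l + orderSign l j + orderSign j k + orderSign k i
        + 2 * (n i k l + n l i j - n j k l - n k i j) = 0) : False := by
  simp (decide := true) only [Fin.forall_fin_succ, orderSign, Fin.isValue, Fin.succ_zero_eq_one,
    Fin.succ_one_eq_two, Fin.reduceSucc, IsEmpty.forall_iff, implies_true, forall_const, and_true,
    true_and, ↓reduceIte] at h
  omega

theorem exists_crossing_identities {ι : Type*} [LinearOrder ι] {p : ι → ℂ}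
    (γ : ∀ i j, Path (p i) (p j)) (hp : Function.Injective p)
    (hv : ∀ i j k, k ≠ i → k ≠ j → p k ∉ Set.range (γ i j))
    (he : ∀ i j k l, i ≠ k → i ≠ l → j ≠ k → j ≠ l →
      Disjoint (Set.range (γ i j)) (Set.range (γ k l))) :
    ∃ n : ι → ι → ι → ℤ, ∀ i j k l, i ≠ k → i ≠ l → j ≠ k → j ≠ l →
      orderSign i l + orderSign l j + orderSign j k + orderSign k i
        + 2 * (n i k l + n l i j - n j k l - n k i j) = 0 := by
  obtain ⟨φ, hφ⟩ := exists_log_sub hp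
  have hne : ∀ k i j, k ≠ i → k ≠ j → ∀ t, p k - (γ i j).extend t ≠ 0 := fun k i j hki hkj t h =>
    hv i j k hki hkj (sub_eq_zero.mp h ▸ Path.extend_range (γ i j) ▸ Set.mem_range_self t)
  have hn : ∀ k i j, ∃ n : ℤ, k ≠ i → k ≠ j → logChange (fun t => p k - (γ i j).extend t) =
      φ k j - φ k i + n * (2 * Real.pi * I) := fun k i j => by
    by_cases h : k ≠ i ∧ k ≠ j
    · obtain ⟨n, hn⟩ := exists_int_logChange_eq
        (continuous_const.sub (γ i j).continuous_extend) (hne k i j h.1 h.2)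
        (by simpa using (hφ k i h.1).1) (by simpa using (hφ k j h.2).1)
      exact ⟨n, fun _ _ => hn⟩
    · exact ⟨0, fun hki hkj => (h ⟨hki, hkj⟩).elim⟩
  choose n hn using hn
  refine ⟨n, fun i j k l hik hil hjk hjl => ?_⟩
  have hab : ∀ s t, (γ i j).extend s ≠ (γ k l).extend t := fun s t =>
    (he i j k l hik hil hjk hjl).ne_of_mem (Path.extend_range (γ i j) ▸ Set.mem_range_self s)
      (Path.extend_range (γ k l) ▸ Set.mem_range_self t)
  have hsquare := logChange_sub_square (γ i j).continuous_extend (γ k l).continuous_extend hab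
  simp only [Path.extend_zero, Path.extend_one] at hsquare
  rw [hn i k l hik hil, hn l i j hil.symm hjl.symm, hn k i j hik.symm hjk.symm,
    hn j k l hjk hjl] at hsquare
  have hπ : (Real.pi * I : ℂ) ≠ 0 := by simp [Real.pi_ne_zero]
  refine Int.cast_injective (α := ℂ) (mul_right_cancel₀ hπ ?_)
  push_cast
  linear_combination hsquare - (hφ i l hil).2 - (hφ l j hjl.symm).2 - (hφ j k hjk).2
    - (hφ k i hik.symm).2

theorem false_of_drawing_five {p : Fin 5 → ℂ} (γ : ∀ i j, Path (p i) (p j))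
    (hv : ∀ i j k, k ≠ i → k ≠ j → p k ∉ Set.range (γ i j))
    (he : ∀ i j k l, i ≠ k → i ≠ l → j ≠ k → j ≠ l →
      Disjoint (Set.range (γ i j)) (Set.range (γ k l))) : False := by
  have hp : Function.Injective p := fun i j hij => by
    by_contra hne
    exact hv j j i hne hne (hij.symm ▸ ⟨0, (γ j j).source⟩)
  obtain ⟨n, hn⟩ := exists_crossing_identities γ hp hv he
  exact false_of_crossing_identities n fun i j k l _ _ => hn i j k l

theorem false_of_five_touching {Q : Fin 5 → Set ℂ} (hdisj : Pairwise (Function.onFun Disjoint Q))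
    (hconn : ∀ i j, IsPathConnected (Q i ∪ Q j)) : False := by
  have hne : ∀ i, (Q i).Nonempty := fun i => by simpa using (hconn i i).nonempty
  choose p hp using hne
  have hjoined : ∀ i j, JoinedIn (Q i ∪ Q j) (p i) (p j) := fun i j =>
    (hconn i j).joinedIn _ (Or.inl (hp i)) _ (Or.inr (hp j))
  have hrange : ∀ i j, Set.range (hjoined i j).somePath ⊆ Q i ∪ Q j := fun i j =>
    Set.range_subset_iff.mpr (hjoined i j).somePath_mem
  refine false_of_drawing_five (fun i j => (hjoined i j).somePath) (fun i j k hki hkj hk => ?_)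
    fun i j k l hik hil hjk hjl => ?_
  · rcases hrange i j hk with h | h
    exacts [(hdisj hki).ne_of_mem (hp k) h rfl, (hdisj hkj).ne_of_mem (hp k) h rfl]
  · refine Disjoint.mono (hrange i j) (hrange k l) ?_
    simp only [Set.disjoint_union_left, Set.disjoint_union_right]
    exact ⟨⟨hdisj hik, hdisj hjk⟩, hdisj hil, hdisj hjl⟩

end DrawingFive

section Minor

open SimpleGraph

variable {U V W : Type*}

/-- `H` is a minor of `G`: there are pairwise disjoint connected sets of vertices of `G`, one for
each vertex of `H`, such that the sets of adjacent vertices of `H` are joined by an edge of `G`. -/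
def IsMinor (H : SimpleGraph W) (G : SimpleGraph V) : Prop :=
  ∃ B : W → Set V, (∀ w, (G.induce (B w)).Connected) ∧ Pairwise (Function.onFun Disjoint B) ∧
    ∀ w w', H.Adj w w' → ∃ a ∈ B w, ∃ b ∈ B w', G.Adj a b

theorem connected_induce_singleton (G : SimpleGraph V) (v : V) : (G.induce {v}).Connected :=
  .of_subsingleton

theorem connected_induce_image {G : SimpleGraph V} {G' : SimpleGraph W} (f : G →g G') {s : Set V}
    (hs : (G.induce s).Connected) : (G'.induce (f '' s)).Connected :=
  hs.map (induceHom f (Set.mapsTo_image f s)) (Set.surjective_mapsTo_image_restrict f s)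

theorem connected_induce_iUnion {H : SimpleGraph W} (hH : H.Connected) {G : SimpleGraph V}
    {C : W → Set V} (hC : ∀ w, (G.induce (C w)).Connected)
    (hadj : ∀ w w', H.Adj w w' → ∃ a ∈ C w, ∃ b ∈ C w', G.Adj a b) :
    (G.induce (⋃ w, C w)).Connected := by
  have := hH.nonempty
  have hsub : ∀ w, C w ⊆ ⋃ w, C w := Set.subset_iUnion C
  have hwithin : ∀ w (a b : V) (ha : a ∈ C w) (hb : b ∈ C w),
      (G.induce (⋃ w, C w)).Reachable ⟨a, hsub w ha⟩ ⟨b, hsub w hb⟩ := fun w a b ha hb =>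
    ((hC w).preconnected ⟨a, ha⟩ ⟨b, hb⟩).map (G.induceHomOfLE (hsub w)).toHom
  have hbetween : ∀ w w', H.Reachable w w' → ∀ (a b : V) (ha : a ∈ C w) (hb : b ∈ C w'),
      (G.induce (⋃ w, C w)).Reachable ⟨a, hsub w ha⟩ ⟨b, hsub w' hb⟩ := by
    rintro w w' ⟨p⟩
    induction p with
    | nil => exact fun a b => hwithin _ a b
    | cons h _ ih =>
      obtain ⟨x, hx, y, hy, hxy⟩ := hadj _ _ h
      exact fun a b ha hb => (hwithin _ a x ha hx).trans <|
        (Adj.reachable (by exact hxy)).trans (ih y b hy hb)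
  have : Nonempty (⋃ w, C w) := by
    obtain ⟨⟨a, ha⟩⟩ := (hC (Classical.arbitrary W)).nonempty
    exact ⟨⟨a, hsub _ ha⟩⟩
  refine ⟨fun ⟨a, ha⟩ ⟨b, hb⟩ => ?_⟩
  obtain ⟨w, haw⟩ := Set.mem_iUnion.mp ha
  obtain ⟨w', hbw'⟩ := Set.mem_iUnion.mp hb
  exact hbetween w w' (hH.preconnected w w') a b haw hbw'

theorem connected_induce_biUnion {H : SimpleGraph W} {S : Set W} (hS : (H.induce S).Connected)
    {G : SimpleGraph V} {C : W → Set V} (hC : ∀ w, (G.induce (C w)).Connected)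
    (hadj : ∀ w w', H.Adj w w' → ∃ a ∈ C w, ∃ b ∈ C w', G.Adj a b) :
    (G.induce (⋃ w ∈ S, C w)).Connected := by
  rw [Set.biUnion_eq_iUnion]
  exact connected_induce_iUnion hS (fun w => hC w) fun w w' h => hadj w w' h

namespace IsMinor

theorem trans {F : SimpleGraph U} {H : SimpleGraph W} {G : SimpleGraph V} (hFH : IsMinor F H)
    (hHG : IsMinor H G) : IsMinor F G := by
  obtain ⟨B, hB, hB_disj, hB_adj⟩ := hFH
  obtain ⟨C, hC, hC_disj, hC_adj⟩ := hHG
  refine ⟨fun u => ⋃ w ∈ B u, C w, fun u => connected_induce_biUnion (hB u) hC hC_adj,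
    fun u u' huu' => ?_, fun u u' huu' => ?_⟩
  · simp only [Function.onFun, Set.disjoint_iUnion_left, Set.disjoint_iUnion_right]
    exact fun w hw w' hw' => hC_disj ((hB_disj huu').ne_of_mem hw' hw)
  · obtain ⟨w, hw, w', hw', hww'⟩ := hB_adj u u' huu'
    obtain ⟨a, ha, b, hb, hab⟩ := hC_adj w w' hww'
    exact ⟨a, Set.mem_biUnion hw ha, b, Set.mem_biUnion hw' hb, hab⟩

theorem of_embedding {H : SimpleGraph W} {G : SimpleGraph V} (f : H ↪g G) : IsMinor H G :=
  ⟨fun w => {f w}, fun w => connected_induce_singleton G (f w),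
    fun _ _ h => by simpa using h,
    fun w w' h => ⟨f w, rfl, f w', rfl, f.map_rel_iff.mpr h⟩⟩

theorem map {G : SimpleGraph V} {f : V → W} (hf : ∀ w, (G.induce (f ⁻¹' {w})).Connected) :
    IsMinor (G.map f) G := by
  refine ⟨fun w => f ⁻¹' {w}, hf, fun w w' h => ?_, fun w w' h => ?_⟩
  · exact (Set.disjoint_singleton.mpr h).preimage f
  · obtain ⟨-, a, b, hab, rfl, rfl⟩ := h
    exact ⟨a, rfl, b, rfl, hab⟩

theorem top_succ_of_neighborSet {G : SimpleGraph V} {v : V} {t : ℕ}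
    (h : IsMinor (⊤ : SimpleGraph (Fin t)) (G.induce (G.neighborSet v))) :
    IsMinor (⊤ : SimpleGraph (Fin (t + 1))) G := by
  obtain ⟨B, hB, hB_disj, hB_adj⟩ := h
  have hv : ∀ i, ∀ b ∈ Subtype.val '' B i, G.Adj v b := by
    rintro i _ ⟨b, -, rfl⟩
    exact b.2
  have hne : ∀ i, ∃ b, b ∈ Subtype.val '' B i := fun i =>
    ((Set.nonempty_coe_sort.mp (hB i).nonempty).image _)
  refine ⟨Fin.cons {v} fun i => Subtype.val '' B i, Fin.cases (connected_induce_singleton G v)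
    fun i => connected_induce_image (Embedding.induce _).toHom (hB i), ?_, ?_⟩
  · refine (pairwise_disjoint_on _).mpr (Fin.cases (Fin.cases (fun h => h.false.elim) fun i _ => ?_)
      fun i => Fin.cases (fun h => (Fin.not_lt_zero _ h).elim) fun j hij => ?_)
    · exact Set.disjoint_singleton_left.mpr fun h => G.irrefl (hv i v h)
    · exact (Set.disjoint_image_iff Subtype.val_injective).mpr
        (hB_disj (Fin.succ_lt_succ_iff.mp hij).ne)
  · refine Fin.cases (Fin.cases (fun h => (h rfl).elim) fun i _ => ?_)
      fun i => Fin.cases (fun _ => ?_) fun j hij => ?_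
    · obtain ⟨b, hb⟩ := hne i
      exact ⟨v, rfl, b, hb, hv i b hb⟩
    · obtain ⟨b, hb⟩ := hne i
      exact ⟨b, hb, v, rfl, (hv i b hb).symm⟩
    · obtain ⟨a, ha, b, hb, hab⟩ := hB_adj i j fun h => hij (congrArg Fin.succ h)
      exact ⟨a, ⟨a, ha, rfl⟩, b, ⟨b, hb, rfl⟩, hab⟩

end IsMinor

end Minor

section PlanarMinor

theorem isPathConnected_iUnion_of_connected {ι E : Type*} [TopologicalSpace E] {G : SimpleGraph ι}
    (hG : G.Connected) {P : ι → Set E} (hP : ∀ i, IsPathConnected (P i))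
    (hadj : ∀ i j, G.Adj i j → IsPathConnected (P i ∪ P j)) : IsPathConnected (⋃ i, P i) := by
  have := hG.nonempty
  have hwithin : ∀ i, ∀ x ∈ P i, ∀ y ∈ P i, JoinedIn (⋃ i, P i) x y := fun i x hx y hy =>
    ((hP i).joinedIn x hx y hy).mono (Set.subset_iUnion P i)
  have hbetween : ∀ i j, G.Reachable i j → ∀ x ∈ P i, ∀ y ∈ P j, JoinedIn (⋃ i, P i) x y := by
    rintro i j ⟨p⟩
    induction p with
    | nil => exact hwithin _
    | @cons i k _ h _ ih =>
      obtain ⟨z, hz⟩ := (hP k).nonempty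
      exact fun x hx y hy => (((hadj _ _ h).joinedIn x (Or.inl hx) z (Or.inr hz)).mono
        (Set.union_subset (Set.subset_iUnion P _) (Set.subset_iUnion P _))).trans (ih z hz y hy)
  refine isPathConnected_iff.mpr ⟨Set.nonempty_iUnion.mpr ?_, fun x hx y hy => ?_⟩
  · exact ⟨Classical.arbitrary ι, (hP _).nonempty⟩
  · obtain ⟨i, hi⟩ := Set.mem_iUnion.mp hx
    obtain ⟨j, hj⟩ := Set.mem_iUnion.mp hy
    exact hbetween i j (hG.preconnected i j) x hi y hj

namespace PlaneDrawing

variable {V : Type*} {G : SimpleGraph V} (D : PlaneDrawing G)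

/-- The point of `v` together with the arcs starting at `v` without their last points. -/
def star (v : V) : Set (EuclideanSpace ℝ (Fin 2)) :=
  {x | x = D.point v ∨ ∃ e, D.arc e 0 = D.point v ∧ ∃ t ∈ Set.Ioo (0 : unitInterval) 1,
    D.arc e t = x}

theorem isPathConnected_star (v : V) : IsPathConnected (D.star v) := by
  refine ⟨D.point v, Or.inl rfl, fun {x} hx => ?_⟩
  rcases hx with rfl | ⟨e, he, t, ht, rfl⟩
  · exact JoinedIn.refl (Or.inl rfl)
  · refine ⟨⟨⟨fun s => D.arc e (s * t), by fun_prop⟩, by simp [he], by simp⟩, fun s => ?_⟩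
    change D.arc e (s * t) ∈ D.star v
    rcases eq_or_lt_of_le (unitInterval.nonneg' (t := s * t)) with h0 | h0
    · rw [← h0, he]
      exact Or.inl rfl
    · exact Or.inr ⟨e, he, s * t, ⟨h0, unitInterval.mul_le_right.trans_lt ht.2⟩, rfl⟩

theorem disjoint_star {u v : V} (huv : u ≠ v) : Disjoint (D.star u) (D.star v) := by
  refine Set.disjoint_left.mpr fun x hu hv => ?_
  rcases hu with rfl | ⟨e, he, s, hs, rfl⟩ <;> rcases hv with h | ⟨f, hf, t, ht, h⟩
  · exact huv (D.point_injective h)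
  · exact D.arc_ne_point f t ht u h
  · exact D.arc_ne_point e s hs v h
  · rcases eq_or_ne e f with rfl | hef
    · exact huv (D.point_injective (he.symm.trans hf))
    · exact D.arc_ne_arc e f hef s hs t ht h.symm

theorem isPathConnected_star_union_of_arc {u v : V} {e : G.edgeSet} (h0 : D.arc e 0 = D.point u)
    (h1 : D.arc e 1 = D.point v) : IsPathConnected (D.star u ∪ D.star v) := by
  have : PathConnectedSpace unitInterval := isPathConnected_iff_pathConnectedSpace.mp
    ((convex_Icc 0 1).isPathConnected ⟨0, by simp⟩)
  have harc : IsPathConnected (Set.range (D.arc e)) := isPathConnected_range (D.arc e).continuous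
  have hsub : Set.range (D.arc e) ⊆ D.star u ∪ D.star v := by
    rintro _ ⟨t, rfl⟩
    rcases eq_or_lt_of_le (unitInterval.nonneg' (t := t)) with rfl | ht0
    · exact Or.inl (Or.inl h0)
    · rcases eq_or_lt_of_le (unitInterval.le_one' (t := t)) with rfl | ht1
      · exact Or.inr (Or.inl h1)
      · exact Or.inl (Or.inr ⟨e, h0, t, ⟨ht0, ht1⟩, rfl⟩)
  have hunion := ((D.isPathConnected_star u).union harc ⟨D.point u, Or.inl rfl, 0, h0⟩).union
    (D.isPathConnected_star v) ⟨D.point v, Or.inr ⟨1, h1⟩, Or.inl rfl⟩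
  rwa [Set.union_right_comm, Set.union_eq_self_of_subset_right hsub] at hunion

theorem isPathConnected_star_union {u v : V} (huv : G.Adj u v) :
    IsPathConnected (D.star u ∪ D.star v) := by
  have hends := D.arc_ends ⟨s(u, v), huv⟩
  rcases Sym2.eq_iff.mp hends with ⟨h0, h1⟩ | ⟨h0, h1⟩
  · exact D.isPathConnected_star_union_of_arc h0 h1
  · rw [Set.union_comm]
    exact D.isPathConnected_star_union_of_arc h0 h1

theorem isPathConnected_biUnion_star {S : Set V} (hS : (G.induce S).Connected) :
    IsPathConnected (⋃ v ∈ S, D.star v) := by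
  rw [Set.biUnion_eq_iUnion]
  exact isPathConnected_iUnion_of_connected hS (fun v => D.isPathConnected_star v)
    fun _ _ h => D.isPathConnected_star_union h

end PlaneDrawing

theorem IsPlanar.not_isMinor_top_five {V : Type*} {G : SimpleGraph V} (h : IsPlanar G) :
    ¬ IsMinor (⊤ : SimpleGraph (Fin 5)) G := by
  obtain ⟨D⟩ := h
  rintro ⟨B, hB, hB_disj, hB_adj⟩
  have hBB : ∀ i j, (G.induce (B i ∪ B j)).Connected := fun i j => by
    rcases eq_or_ne i j with rfl | hij
    · rw [Set.union_self]
      exact hB i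
    · obtain ⟨a, ha, b, hb, hab⟩ := hB_adj i j hij
      exact SimpleGraph.connected_induce_union (hB i).preconnected (hB j).preconnected ha hb hab
  let φ := Complex.orthonormalBasisOneI.repr.symm
  refine false_of_five_touching (Q := fun i => φ '' ⋃ v ∈ B i, D.star v) (fun i j hij => ?_)
    fun i j => ?_
  · simp only [Function.onFun, Set.disjoint_image_iff φ.injective, Set.disjoint_iUnion_left,
      Set.disjoint_iUnion_right]
    exact fun v hv u hu => D.disjoint_star ((hB_disj hij).ne_of_mem hu hv)
  · rw [← Set.image_union, ← Set.biUnion_union]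
    exact (D.isPathConnected_biUnion_star (hBB i j)).image φ.continuous

end PlanarMinor

section Mader

universe u

open SimpleGraph

theorem ncard_edgeSet_le_ncard_edgeSet_map_add {V W : Type*} [Finite V] [Finite W]
    {G : SimpleGraph V} {f : V → W} {D : Set (Sym2 V)}
    (hD : ∀ a b, G.Adj a b → f a = f b → s(a, b) ∈ D)
    (hf : Set.InjOn (Sym2.map f) (G.edgeSet \ D)) :
    G.edgeSet.ncard ≤ (G.map f).edgeSet.ncard + D.ncard := by
  have hmaps : ∀ e ∈ G.edgeSet \ D, Sym2.map f e ∈ (G.map f).edgeSet := by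
    refine Sym2.ind fun a b hab => ?_
    exact map_adj_apply' hab.1 fun h => hab.2 (hD a b hab.1 h)
  have hle := Set.ncard_le_ncard_of_injOn _ hmaps hf
  have hdiff := Set.ncard_le_ncard_sdiff_add_ncard G.edgeSet D
  omega

variable {V : Type*} {G : SimpleGraph V} {u v : V}

open Classical in
/-- The map merging `v` into another vertex `u`, so that `G.map (mergeInto h)` is the contraction of
the edge `uv` of a graph `G`. -/
noncomputable def mergeInto (huv : u ≠ v) (x : V) : {x // x ≠ v} :=
  if hx : x = v then ⟨u, huv⟩ else ⟨x, hx⟩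

theorem mergeInto_eq_iff (huv : u ≠ v) {x y : V} :
    mergeInto huv x = mergeInto huv y ↔ x = y ∨ x = u ∧ y = v ∨ x = v ∧ y = u := by
  unfold mergeInto
  grind

theorem isMinor_map_mergeInto (huv : G.Adj u v) : IsMinor (G.map (mergeInto huv.ne)) G := by
  refine IsMinor.map fun ⟨x, hx⟩ => ?_
  rcases eq_or_ne x u with rfl | hxu
  · have hfibre : mergeInto huv.ne ⁻¹' {⟨x, hx⟩} = {x, v} := by
      ext y
      simp only [Set.mem_preimage, Set.mem_singleton_iff, Set.mem_insert_iff, mergeInto]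
      grind
    exact hfibre ▸ induce_pair_connected_of_adj huv
  · have hfibre : mergeInto huv.ne ⁻¹' {⟨x, hx⟩} = {x} := by
      ext y
      simp only [Set.mem_preimage, Set.mem_singleton_iff, mergeInto]
      grind
    exact hfibre ▸ connected_induce_singleton G x

theorem ncard_edgeSet_le_ncard_edgeSet_contract [Finite V] (huv : G.Adj u v) :
    G.edgeSet.ncard ≤
      (G.map (mergeInto huv.ne)).edgeSet.ncard + ((G.commonNeighbors u v).ncard + 1) := by
  refine (ncard_edgeSet_le_ncard_edgeSet_map_add (f := mergeInto huv.ne)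
    (D := insert s(u, v) ((fun w => s(v, w)) '' G.commonNeighbors u v)) ?_ ?_).trans ?_
  · intro a b hab h
    have := hab.ne
    rw [mergeInto_eq_iff] at h
    grind [Sym2.eq_swap]
  · refine Sym2.ind fun a b hab => Sym2.ind fun c d hcd h => ?_
    simp only [Set.mem_sdiff, Set.mem_insert_iff, Set.mem_image, mem_commonNeighbors, Sym2.map_mk,
      Sym2.eq_iff, mergeInto_eq_iff, mem_edgeSet] at hab hcd h ⊢
    grind [SimpleGraph.Adj.symm]
  · have himage := Set.ncard_image_le (f := fun w => s(v, w)) (G.commonNeighbors u v).toFinite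
    exact Nat.add_le_add_left ((Set.ncard_insert_le _ _).trans (Nat.succ_le_succ himage)) _

theorem exists_isMinor_forall_adj_le_ncard_commonNeighbors {c : ℕ} {V : Type u} [Finite V]
    [Nonempty V] {G : SimpleGraph V} (hG : c * Nat.card V ≤ G.edgeSet.ncard) :
    ∃ (W : Type u) (_ : Finite W) (_ : Nonempty W) (H : SimpleGraph W), IsMinor H G ∧
      c * Nat.card W ≤ H.edgeSet.ncard ∧
        ∀ u v, H.Adj u v → c ≤ (H.commonNeighbors u v).ncard := by
  induction hn : Nat.card V using Nat.strong_induction_on generalizing V with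
  | _ n ih =>
  by_cases hc : ∀ u v, G.Adj u v → c ≤ (G.commonNeighbors u v).ncard
  · exact ⟨V, ‹_›, ‹_›, G, .of_embedding Embedding.refl, hG, hc⟩
  · push Not at hc
    obtain ⟨u, v, huv, hlt⟩ := hc
    have hcard : Nat.card {x // x ≠ v} + 1 = n := by
      have := Set.ncard_add_ncard_compl {v}
      rw [Set.ncard_singleton, hn] at this
      rw [← this, add_comm]
      rfl
    have : Nonempty {x // x ≠ v} := ⟨u, huv.ne⟩
    have hedges := ncard_edgeSet_le_ncard_edgeSet_contract huv
    obtain ⟨W, _, _, H, hH, hHG⟩ := ih _ (by omega) (G := G.map (mergeInto huv.ne))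
      (by rw [hn, ← hcard, mul_add] at hG; omega) rfl
    exact ⟨W, ‹_›, ‹_›, H, hH.trans (isMinor_map_mergeInto huv), hHG⟩

theorem sum_ncard_neighborSet_eq {V : Type*} [Fintype V] (G : SimpleGraph V) :
    ∑ v, (G.neighborSet v).ncard = 2 * G.edgeSet.ncard := by
  classical
  rw [← coe_edgeFinset, Set.ncard_coe_finset, ← sum_degrees_eq_twice_card_edges]
  exact Finset.sum_congr rfl fun v _ => Set.ncard_eq_toFinset_card' _

theorem mul_card_le_two_mul_ncard_edgeSet {c : ℕ} {V : Type*} [Finite V] {G : SimpleGraph V}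
    (hG : ∀ v, c ≤ (G.neighborSet v).ncard) : c * Nat.card V ≤ 2 * G.edgeSet.ncard := by
  have := Fintype.ofFinite V
  rw [← sum_ncard_neighborSet_eq, mul_comm, Nat.card_eq_fintype_card]
  exact Finset.card_nsmul_le_sum _ _ _ fun v _ => hG v

theorem isMinor_top_of_two_pow_mul_card_le {t : ℕ} {V : Type u} [Finite V] [Nonempty V]
    {G : SimpleGraph V} (hG : 2 ^ t * Nat.card V ≤ G.edgeSet.ncard) :
    IsMinor (⊤ : SimpleGraph (Fin (t + 1))) G := by
  induction t generalizing V with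
  | zero =>
    obtain ⟨v⟩ := ‹Nonempty V›
    exact .top_succ_of_neighborSet (v := v)
      ⟨Fin.elim0, fun i => i.elim0, fun i => i.elim0, fun i => i.elim0⟩
  | succ t ih =>
    obtain ⟨W, _, _, H, hHG, hH, hc⟩ := exists_isMinor_forall_adj_le_ncard_commonNeighbors hG
    have hpos : 0 < 2 ^ (t + 1) * Nat.card W := Nat.mul_pos (by positivity) Nat.card_pos
    obtain ⟨⟨u, v⟩, huv : H.Adj u v⟩ := Set.nonempty_of_ncard_ne_zero (hpos.trans_le hH).ne'
    have : Nonempty (H.neighborSet u) := ⟨v, huv⟩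
    refine (IsMinor.top_succ_of_neighborSet (v := u) (ih ?_)).trans hHG
    refine Nat.le_of_mul_le_mul_left ?_ two_pos
    rw [← mul_assoc, ← pow_succ']
    refine mul_card_le_two_mul_ncard_edgeSet fun w => (hc u w w.2).trans ?_
    rw [← Set.ncard_image_of_injective _ Subtype.val_injective]
    exact Set.ncard_le_ncard fun x hx => ⟨⟨x, hx.1⟩, hx.2, rfl⟩

theorem IsPlanar.ncard_edgeSet_lt_of_isMinor {V : Type*} {W : Type*} [Finite W] [Nonempty W]
    {G : SimpleGraph V} {H : SimpleGraph W} (hG : IsPlanar G) (hH : IsMinor H G) :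
    H.edgeSet.ncard < 16 * Nat.card W := by
  by_contra! h
  exact hG.not_isMinor_top_five ((isMinor_top_of_two_pow_mul_card_le (t := 4) h).trans hH)

end Mader

section Girth

open SimpleGraph

variable {V : Type*} {G : SimpleGraph V}

theorem egirth_le_length_add_one {a b : V} (hab : G.Adj a b) (p : G.Walk a b)
    (hp : s(a, b) ∉ p.edges) : G.egirth ≤ p.length + 1 := by
  classical
  have hcycle : (Walk.cons hab.symm p.bypass).IsCycle :=
    (Walk.cons_isCycle_iff _ _).mpr ⟨p.bypass_isPath,
      fun h => hp (Sym2.eq_swap ▸ p.edges_bypass_subset_edges h)⟩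
  refine (egirth_le_length hcycle).trans ?_
  rw [Walk.length_cons]
  exact_mod_cast Nat.succ_le_succ p.length_bypass_le_length

section AncestorIn

variable {S : Set V} {π : V → V} {m : V → ℕ}

open Classical in
/-- The first vertex of `S` on the sequence `v, π v, π (π v), …` of ancestors of `v`, where `π` is a
parent map along which `m` decreases outside `S`. -/
noncomputable def ancestorIn (hm : ∀ v ∉ S, m (π v) < m v) (v : V) : S :=
  if hv : v ∈ S then ⟨v, hv⟩ else ancestorIn hm (π v)
termination_by m v
decreasing_by exact hm v hv

variable {hm : ∀ v ∉ S, m (π v) < m v}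

theorem ancestorIn_of_mem {v : V} (hv : v ∈ S) : ancestorIn hm v = ⟨v, hv⟩ := by
  rw [ancestorIn, dif_pos hv]

theorem ancestorIn_of_notMem {v : V} (hv : v ∉ S) : ancestorIn hm v = ancestorIn hm (π v) := by
  rw [ancestorIn, dif_neg hv]

theorem connected_induce_ancestorIn_fiber (hπ : ∀ v ∉ S, G.Adj v (π v)) (c : S) :
    (G.induce (ancestorIn hm ⁻¹' {c})).Connected := by
  have hc : ancestorIn hm (c : V) = c := ancestorIn_of_mem c.2
  suffices h : ∀ v (hv : ancestorIn hm v = c),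
      (G.induce (ancestorIn hm ⁻¹' {c})).Reachable ⟨v, hv⟩ ⟨c, hc⟩ from
    connected_iff_exists_forall_reachable _ |>.mpr ⟨⟨c, hc⟩, fun v => (h v v.2).symm⟩
  intro v hv
  induction hk : m v using Nat.strong_induction_on generalizing v with
  | _ k ih =>
  by_cases hvS : v ∈ S
  · obtain rfl : (⟨v, hvS⟩ : S) = c := (ancestorIn_of_mem hvS).symm.trans hv
    rfl
  · have hv' : ancestorIn hm (π v) = c := (ancestorIn_of_notMem hvS).symm.trans hv
    have hadj : (G.induce (ancestorIn hm ⁻¹' {c})).Adj ⟨v, hv⟩ ⟨π v, hv'⟩ := hπ v hvS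
    exact hadj.reachable.trans (ih _ (hk ▸ hm v hvS) _ hv' rfl)

theorem exists_walk_ancestorIn (hπ : ∀ v ∉ S, G.Adj v (π v)) (v : V) :
    ∃ p : G.Walk v (ancestorIn hm v),
      p.length ≤ m v ∧ ∀ e ∈ p.edges, e ∈ (fun x => s(x, π x)) '' Sᶜ := by
  induction hk : m v using Nat.strong_induction_on generalizing v with
  | _ k ih =>
  by_cases hv : v ∈ S
  · rw [ancestorIn_of_mem hv]
    exact ⟨.nil, by simp⟩
  · obtain ⟨p, hp, hedges⟩ := ih _ (hk ▸ hm v hv) (π v) rfl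
    rw [ancestorIn_of_notMem hv]
    refine ⟨.cons (hπ v hv) p, ?_, ?_⟩
    · have := hm v hv
      rw [Walk.length_cons]
      omega
    · rw [Walk.edges_cons, List.forall_mem_cons]
      exact ⟨⟨v, hv, rfl⟩, hedges⟩

theorem reachable_ancestorIn (hπ : ∀ v ∉ S, G.Adj v (π v)) (v : V) :
    G.Reachable v (ancestorIn hm v) :=
  (exists_walk_ancestorIn hπ v).choose.reachable

theorem exists_walk_of_ancestorIn_eq {r : ℕ} (hπ : ∀ v ∉ S, G.Adj v (π v)) (hr : ∀ v, m v < r)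
    {a b : V} (hab : ancestorIn hm a = ancestorIn hm b) :
    ∃ p : G.Walk a b,
      p.length + 2 ≤ 2 * r ∧ ∀ e ∈ p.edges, e ∈ (fun x => s(x, π x)) '' Sᶜ := by
  obtain ⟨p, hp, hpT⟩ := exists_walk_ancestorIn (hm := hm) hπ a
  obtain ⟨q, hq, hqT⟩ := hab ▸ exists_walk_ancestorIn (hm := hm) hπ b
  refine ⟨p.append q.reverse, ?_, ?_⟩
  · have := hr a
    have := hr b
    rw [Walk.length_append, Walk.length_reverse]
    omega
  · simp only [Walk.edges_append, Walk.edges_reverse, List.mem_append, List.mem_reverse]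
    exact fun e he => he.elim (hpT e) (hqT e)

theorem injOn_map_ancestorIn {r : ℕ} (hπ : ∀ v ∉ S, G.Adj v (π v)) (hr : ∀ v, m v < r)
    (hG : (4 * r : ℕ) ≤ G.egirth) :
    Set.InjOn (Sym2.map (ancestorIn hm)) (G.edgeSet \ (fun x => s(x, π x)) '' Sᶜ) := by
  have hinj : ∀ a b c d, G.Adj a b → s(a, b) ∉ (fun x => s(x, π x)) '' Sᶜ → G.Adj c d →
      ancestorIn hm a = ancestorIn hm c → ancestorIn hm b = ancestorIn hm d →
      s(a, b) = s(c, d) := by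
    intro a b c d hab habT hcd hac hbd
    by_contra hne
    obtain ⟨p, hp, hpT⟩ := exists_walk_of_ancestorIn_eq hπ hr hac
    obtain ⟨q, hq, hqT⟩ := exists_walk_of_ancestorIn_eq hπ hr hbd.symm
    have hle := hG.trans (egirth_le_length_add_one hab (p.append (.cons hcd q)) ?_)
    · rw [Walk.length_append, Walk.length_cons] at hle
      norm_cast at hle
      omega
    · simp only [Walk.edges_append, Walk.edges_cons, List.mem_append, List.mem_cons, not_or]
      exact ⟨fun h => habT (hpT _ h), hne, fun h => habT (hqT _ h)⟩
  refine Sym2.ind fun a b hab => Sym2.ind fun c d hcd h => ?_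
  rcases Sym2.eq_iff.mp h with ⟨hac, hbd⟩ | ⟨had, hbc⟩
  · exact hinj a b c d hab.1 hab.2 hcd.1 hac hbd
  · exact (hinj a b d c hab.1 hab.2 hcd.1.symm had hbc).trans Sym2.eq_swap

theorem ncard_edgeSet_le_ncard_edgeSet_map_ancestorIn [Finite V] {r : ℕ}
    (hπ : ∀ v ∉ S, G.Adj v (π v)) (hr : ∀ v, m v < r) (hG : (4 * r : ℕ) ≤ G.egirth) :
    G.edgeSet.ncard ≤ (G.map (ancestorIn hm)).edgeSet.ncard + Nat.card V := by
  refine (ncard_edgeSet_le_ncard_edgeSet_map_add (D := (fun x => s(x, π x)) '' Sᶜ) ?_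
    (injOn_map_ancestorIn hπ hr hG)).trans
      (Nat.add_le_add_left ((Set.ncard_image_le Sᶜ.toFinite).trans (Set.ncard_le_card _)) _)
  intro a b hab h
  by_contra habT
  obtain ⟨p, hp, hpT⟩ := exists_walk_of_ancestorIn_eq hπ hr h
  have hle := hG.trans (egirth_le_length_add_one hab p fun h => habT (hpT _ h))
  norm_cast at hle
  omega

end AncestorIn

theorem exists_adj_dist_add_one_eq {u v : V} (huv : G.Reachable u v) (hne : u ≠ v) :
    ∃ w, G.Adj v w ∧ G.dist u w + 1 = G.dist u v := by
  obtain ⟨p, hp⟩ := huv.symm.exists_walk_length_eq_dist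
  cases p with
  | nil => exact absurd rfl hne
  | @cons _ w _ h p =>
    refine ⟨w, h, ?_⟩
    rw [Walk.length_cons, SimpleGraph.dist_comm] at hp
    have hle := dist_le p
    have hdiff := h.diff_dist_adj (u := u)
    rw [SimpleGraph.dist_comm] at hle
    omega

theorem exists_mul_ncard_dvd_add_le [Finite V] (d : V → ℕ) {r : ℕ} (hr : 0 < r) :
    ∃ k, r * {v | r ∣ d v + k}.ncard ≤ Nat.card V := by
  have := Fintype.ofFinite V
  obtain ⟨i, hi, hcard⟩ := Finset.exists_card_fiber_le_of_card_le_nsmul (s := Finset.univ)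
    (t := Finset.range r) (f := fun v => d v % r) (b := (Nat.card V / r : ℚ)) ⟨0, by simpa⟩
    (by simp [mul_div_cancel₀, hr.ne'])
  refine ⟨r - i, ?_⟩
  have hi' := Finset.mem_range.mp hi
  have hset : {v | r ∣ d v + (r - i)} = ({v | d v % r = i} : Finset V) := by
    ext v
    simp only [Set.mem_ofPred_eq, Finset.coe_filter, Finset.mem_univ, true_and]
    rw [← ZMod.natCast_eq_zero_iff, Nat.cast_add, Nat.cast_sub hi'.le, ZMod.natCast_self, zero_sub,
      ← sub_eq_add_neg, sub_eq_zero, ZMod.natCast_eq_natCast_iff', Nat.mod_eq_of_lt hi']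
  rw [hset, Set.ncard_coe_finset]
  rw [le_div_iff₀' (by exact_mod_cast hr)] at hcard
  exact_mod_cast hcard

theorem mod_lt_succ_mod {k r : ℕ} (h : ¬ r ∣ k + 1) : k % r < (k + 1) % r := by
  have hk := Nat.div_add_mod k r
  have hk' := Nat.div_add_mod (k + 1) r
  rw [Nat.succ_div_of_not_dvd h] at hk'
  linarith

theorem image_support_map_subset {S L : Set V} {f : V → S} {root : V → V}
    (hf : ∀ v, G.Reachable v (f v)) (hroot : ∀ u v, G.Reachable u v → root u = root v)
    (hS : ∀ v ∈ S, v ∈ L ∨ root v = v) :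
    Subtype.val '' (G.map f).support ⊆ L ∪ root '' L := by
  rintro _ ⟨c, ⟨c', hne, a, b, hab, rfl, rfl⟩, rfl⟩
  -- Of the two ends of an edge of `G.map f`, at most one is the root of their component.
  have hreach : G.Reachable (f a) (f b) := (hf a).symm.trans (hab.reachable.trans (hf b))
  rcases hS _ (f a).2 with ha | ha
  · exact .inl ha
  · have hb : root (f b) = f a := (hroot _ _ hreach).symm.trans ha
    refine .inr ⟨f b, (hS _ (f b).2).resolve_right fun hb' => hne ?_, hb⟩
    exact Subtype.ext (hb.symm.trans hb')

theorem exists_isMinor_mul_ncard_support_le [Finite V] {r : ℕ} (hr : 0 < r)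
    (hG : (4 * r : ℕ) ≤ G.egirth) :
    ∃ (S : Set V) (H : SimpleGraph S), IsMinor H G ∧
      G.edgeSet.ncard ≤ H.edgeSet.ncard + Nat.card V ∧
        r * H.support.ncard ≤ 2 * Nat.card V := by
  let root v := (G.connectedComponentMk v).out
  have hroot : ∀ v, G.Reachable (root v) v := fun v => ConnectedComponent.exact (Quot.out_eq _)
  have hroot' : ∀ u v, G.Reachable u v → root u = root v := fun u v h =>
    congrArg Quot.out (ConnectedComponent.sound h)
  set d : V → ℕ := fun v => G.dist (root v) v with hd
  have hparent : ∀ v, root v ≠ v → ∃ w, G.Adj v w ∧ d w + 1 = d v := by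
    intro v hv
    obtain ⟨w, hvw, hw⟩ := exists_adj_dist_add_one_eq (hroot v) hv
    exact ⟨w, hvw, by simp only [hd]; rwa [← hroot' v w hvw.reachable]⟩
  choose! π hπ hdπ using hparent
  obtain ⟨k, hk⟩ := exists_mul_ncard_dvd_add_le d hr
  set L := {v | r ∣ d v + k} with hL
  have hadj : ∀ v ∉ L ∪ {v | root v = v}, G.Adj v (π v) := fun v hv => hπ v (hv <| .inr ·)
  let m v := (d v + k) % r
  have hm : ∀ v ∉ L ∪ {v | root v = v}, m (π v) < m v := by
    intro v hv
    have hsucc : d v + k = d (π v) + k + 1 := by rw [← hdπ v (hv <| .inr ·), add_right_comm]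
    simp only [m, hsucc]
    exact mod_lt_succ_mod fun h => hv (.inl (by rwa [hL, Set.mem_ofPred_eq, hsucc]))
  refine ⟨_, G.map (ancestorIn hm), .map (connected_induce_ancestorIn_fiber hadj),
    ncard_edgeSet_le_ncard_edgeSet_map_ancestorIn hadj (fun v => Nat.mod_lt _ hr) hG, ?_⟩
  have hsupport := Set.ncard_le_ncard
    (image_support_map_subset (reachable_ancestorIn (hm := hm) hadj) hroot' fun v hv => hv)
  rw [Set.ncard_image_of_injective _ Subtype.val_injective] at hsupport
  have hunion := Set.ncard_union_le L (root '' L)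
  have himage := Set.ncard_image_le (f := root) L.toFinite
  nlinarith

theorem IsPlanar.ncard_edgeSet_le_of_isMinor {W : Type*} [Finite W] {H : SimpleGraph W}
    (hG : IsPlanar G) (hH : IsMinor H G) : H.edgeSet.ncard ≤ 16 * H.support.ncard := by
  classical
  have := Fintype.ofFinite W
  rcases H.support.eq_empty_or_nonempty with hempty | hne
  · simp [H.support_eq_bot_iff.mp hempty]
  · have := hne.to_subtype
    have hlt := hG.ncard_edgeSet_lt_of_isMinor
      ((IsMinor.of_embedding (Embedding.induce H.support)).trans hH)
    have hcard := card_edgeFinset_induce_support (G := H)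
    rw [← Set.ncard_coe_finset, ← Set.ncard_coe_finset, coe_edgeFinset, coe_edgeFinset] at hcard
    rw [hcard] at hlt
    exact hlt.le

theorem IsPlanar.mul_ncard_edgeSet_le [Finite V] {r : ℕ} (hr : 0 < r) (hG : IsPlanar G)
    (hgirth : (4 * r : ℕ) ≤ G.egirth) : r * G.edgeSet.ncard ≤ (r + 32) * Nat.card V := by
  obtain ⟨S, H, hHG, hedges, hsupport⟩ := exists_isMinor_mul_ncard_support_le hr hgirth
  have hH := hG.ncard_edgeSet_le_of_isMinor hHG
  nlinarith

end Girth

section AddEdge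

open SimpleGraph

variable {V : Type*} {G : SimpleGraph V} {x y : V}

theorem exists_walk_of_isCycle_of_mem_edges {a : V} {c : G.Walk a a} (hc : c.IsCycle)
    (hxy : s(x, y) ∈ c.edges) :
    ∃ p : G.Walk y x, p.length + 1 = c.length ∧ s(x, y) ∉ p.edges := by
  classical
  have hsnd : ∀ w : G.Walk x x, w.IsCycle → w.snd = y →
      ∃ p : G.Walk y x, p.length + 1 = w.length ∧ s(x, y) ∉ p.edges := by
    rintro (_ | ⟨h, p⟩) hw hy
    · exact absurd rfl hw.ne_nil
    · rw [Walk.snd_cons] at hy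
      subst hy
      exact ⟨p, rfl, ((Walk.cons_isCycle_iff p h).mp hw).2⟩
  have hx : x ∈ c.support := c.fst_mem_support_of_mem_edges hxy
  have hrot := hc.rotate hx
  have hy : y ∈ (c.rotate x hx).toSubgraph.neighborSet x := by
    rw [Subgraph.mem_neighborSet, Walk.toSubgraph_rotate]
    exact Walk.adj_toSubgraph_iff_mem_edges.mpr hxy
  rw [hrot.neighborSet_toSubgraph_endpoint] at hy
  rw [← c.length_rotate x hx]
  rcases hy with hy | hy
  · exact hsnd _ hrot hy.symm
  · rw [← Walk.length_reverse]
    exact hsnd _ hrot.reverse (by rw [Walk.snd_reverse, hy])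

theorem le_egirth_sup_edge {K : ℕ∞} (hG : K ≤ G.egirth) (hxy : K ≤ G.edist x y + 1) :
    K ≤ (G ⊔ edge x y).egirth := by
  have htransfer : ∀ {a b} {p : (G ⊔ edge x y).Walk a b}, s(x, y) ∉ p.edges →
      ∀ e ∈ p.edges, e ∈ G.edgeSet := by
    intro a b p hp e he
    have hmem := p.edges_subset_edgeSet he
    rw [edgeSet_sup] at hmem
    refine hmem.resolve_right fun h => hp ?_
    rwa [← edgeSet_edge_subset h]
  refine le_egirth.mpr fun a c hc => ?_
  by_cases hmem : s(x, y) ∈ c.edges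
  · obtain ⟨p, hp, hpxy⟩ := exists_walk_of_isCycle_of_mem_edges hc hmem
    have hle := edist_le (p.transfer G (htransfer hpxy))
    rw [Walk.length_transfer, edist_comm] at hle
    rw [← hp]
    exact_mod_cast hxy.trans (add_le_add_left hle 1)
  · have hle := hG.trans (egirth_le_length (hc.transfer (htransfer hmem)))
    rwa [Walk.length_transfer] at hle

theorem ncard_neighborSet_sup_edge_le [Finite V] {Δ : ℕ} (hG : ∀ v, (G.neighborSet v).ncard ≤ Δ)
    (hx : (G.neighborSet x).ncard < Δ) (hy : (G.neighborSet y).ncard < Δ) (v : V) :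
    ((G ⊔ edge x y).neighborSet v).ncard ≤ Δ := by
  by_cases hv : ∃ w, s(v, w) = s(x, y)
  · obtain ⟨w, hvw⟩ := hv
    have hlt : (G.neighborSet v).ncard < Δ := by
      rcases Sym2.eq_iff.mp hvw with ⟨rfl, -⟩ | ⟨rfl, -⟩
      exacts [hx, hy]
    have hsub : (G ⊔ edge x y).neighborSet v ⊆ insert w (G.neighborSet v) := by
      rintro u (hu | hu)
      · exact .inr hu
      · exact .inl (Sym2.congr_right.mp (((adj_edge x y).mp hu).1.symm.trans hvw.symm))
    have hcard := Set.ncard_le_ncard hsub (Set.toFinite _)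
    have hinsert := Set.ncard_insert_le w (G.neighborSet v)
    omega
  · have hsub : (G ⊔ edge x y).neighborSet v ⊆ G.neighborSet v := by
      rintro u (hu | hu)
      · exact hu
      · exact absurd ⟨u, ((adj_edge x y).mp hu).1.symm⟩ hv
    exact (Set.ncard_le_ncard hsub (Set.toFinite _)).trans (hG v)

theorem ball_add_one_subset (v : V) (k : ℕ) :
    G.ball v (k + 1 + 1) ⊆ ⋃ w ∈ G.ball v (k + 1), insert w (G.neighborSet w) := by
  intro u hu
  obtain ⟨p, hp⟩ := exists_walk_of_edist_ne_top (mem_ball.mp hu).ne_top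
  rw [mem_ball, ← hp] at hu
  cases p with
  | nil => exact Set.mem_biUnion (mem_ball_self (by positivity)) (.inl rfl)
  | @cons _ w _ h p =>
    refine Set.mem_biUnion (x := w) (mem_ball.mpr ((edist_le p).trans_lt ?_)) (.inr h.symm)
    rw [Walk.length_cons] at hu
    norm_cast at hu ⊢
    omega

theorem ncard_ball_le [Finite V] {Δ : ℕ} (hG : ∀ v, (G.neighborSet v).ncard ≤ Δ) (v : V) (k : ℕ) :
    (G.ball v (k + 1)).ncard ≤ (Δ + 1) ^ k := by
  have := Fintype.ofFinite V
  classical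
  induction k with
  | zero => simp
  | succ k ih =>
    calc (G.ball v ((k + 1 : ℕ) + 1)).ncard
        ≤ (⋃ w ∈ (G.ball v (k + 1)).toFinset, insert w (G.neighborSet w)).ncard := by
          refine Set.ncard_le_ncard ?_ (Set.toFinite _)
          simpa using ball_add_one_subset v k
      _ ≤ ∑ w ∈ (G.ball v (k + 1)).toFinset, (insert w (G.neighborSet w)).ncard :=
          Finset.set_ncard_biUnion_le _ _
      _ ≤ (G.ball v (k + 1)).toFinset.card • (Δ + 1) :=
          Finset.sum_le_card_nsmul _ _ _ fun w _ =>
            (Set.ncard_insert_le _ _).trans (Nat.succ_le_succ (hG w))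
      _ ≤ (Δ + 1) ^ (k + 1) := by
          rw [← Set.ncard_eq_toFinset_card', smul_eq_mul, pow_succ]
          exact Nat.mul_le_mul_right _ ih

theorem ncard_le_ncard_neighborSet_mul_le [Finite V] (Δ : ℕ) :
    {v | Δ ≤ (G.neighborSet v).ncard}.ncard * Δ ≤ 2 * G.edgeSet.ncard := by
  have := Fintype.ofFinite V
  classical
  rw [← sum_ncard_neighborSet_eq, Set.ncard_eq_toFinset_card', ← smul_eq_mul]
  refine (Finset.card_nsmul_le_sum _ (fun v => (G.neighborSet v).ncard) Δ fun v hv => ?_).trans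
    (Finset.sum_le_univ_sum_of_nonneg fun _ => Nat.zero_le _)
  simpa using hv

theorem exists_mk_mem_of_ncard_lt [Finite V] {A : Set (V × V)} {F : Finset (Sym2 V)}
    (hA : A.ncard < F.card) : ∃ x y, s(x, y) ∈ F ∧ (x, y) ∉ A ∧ (y, x) ∉ A := by
  have hcard : (Sym2.mk.uncurry '' A).ncard < (F : Set (Sym2 V)).ncard := by
    rw [Set.ncard_coe_finset]
    exact (Set.ncard_image_le A.toFinite).trans_lt hA
  obtain ⟨⟨x, y⟩, heF, heA⟩ := Set.exists_mem_notMem_of_ncard_lt_ncard hcard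
  exact ⟨x, y, heF, fun h => heA ⟨_, h, rfl⟩, fun h => heA ⟨_, h, Sym2.eq_swap⟩⟩

theorem ncard_setOf_snd_mem_le [Finite V] {B : V → Set V} {c : ℕ} (hB : ∀ x, (B x).ncard ≤ c) :
    {p : V × V | p.2 ∈ B p.1}.ncard ≤ Nat.card V * c := by
  have := Fintype.ofFinite V
  have hunion : {p : V × V | p.2 ∈ B p.1} = ⋃ x, {x} ×ˢ B x := by
    ext ⟨x, y⟩
    simp
  calc {p : V × V | p.2 ∈ B p.1}.ncard
      ≤ ∑ x, ({x} ×ˢ B x).ncard := hunion ▸ Set.ncard_iUnion_le_of_fintype _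
    _ ≤ Fintype.card V • c := Finset.sum_le_card_nsmul _ _ _ fun x _ => by
        rw [Set.ncard_prod, Set.ncard_singleton, one_mul]
        exact hB x
    _ = Nat.card V * c := by rw [Nat.card_eq_fintype_card, smul_eq_mul]

/-- The invariant of Maker's graph: its degrees are at most `Δ` and it has no cycle shorter than
`g`. -/
def IsSparse (Δ g : ℕ) (G : SimpleGraph V) : Prop :=
  (∀ v, (G.neighborSet v).ncard ≤ Δ) ∧ g ≤ G.egirth

theorem isSparse_bot (Δ g : ℕ) : IsSparse Δ g (⊥ : SimpleGraph V) := by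
  simp [IsSparse]

theorem IsSparse.exists_isSparse_sup_edge [Finite V] {Δ g : ℕ} (hG : IsSparse Δ g G)
    {F : Finset (Sym2 V)} (hF : {v | Δ ≤ (G.neighborSet v).ncard}.ncard * Nat.card V +
      Nat.card V * (Δ + 1) ^ g < F.card) :
    ∃ x y, s(x, y) ∈ F ∧ IsSparse Δ g (G ⊔ edge x y) := by
  set L := {v | Δ ≤ (G.neighborSet v).ncard}
  obtain ⟨x, y, hxyF, hxy, hyx⟩ := exists_mk_mem_of_ncard_lt
    (A := L ×ˢ Set.univ ∪ {p : V × V | p.2 ∈ G.ball p.1 (g + 1)}) <| by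
      refine ((Set.ncard_union_le _ _).trans (add_le_add ?_ ?_)).trans_lt hF
      · rw [Set.ncard_prod, Set.ncard_univ]
      · exact ncard_setOf_snd_mem_le fun x => ncard_ball_le hG.1 x g
  simp only [Set.mem_union, Set.mem_prod, Set.mem_univ, and_true, not_or, L, Set.mem_ofPred_eq,
    not_le, mem_ball, not_lt] at hxy hyx
  exact ⟨x, y, hxyF, ncard_neighborSet_sup_edge_le hG.1 hxy.1 hyx.1, le_egirth_sup_edge hG.2 <|
    le_self_add.trans (hyx.2.trans le_self_add)⟩

end AddEdge

section Game

variable {α : Type*} [DecidableEq α] {board : Finset α} {H : Set (Finset α)} {b : ℕ}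

theorem isLegalClaim_singleton {M B : Finset α} {x : α} (hx : x ∈ board \ (M ∪ B)) :
    IsLegalClaim board 1 M B {x} := by
  refine ⟨Finset.singleton_subset_iff.mpr hx, ?_⟩
  have := Finset.card_pos.mpr ⟨x, hx⟩
  rw [Finset.card_singleton]
  omega

theorem MakerWinsFrom.of_subset {M B A : Finset α} (hA : A ∈ H) (hAM : A ⊆ M) :
    MakerWinsFrom board H 1 b M B := by
  induction hk : (board \ (M ∪ B)).card using Nat.strong_induction_on generalizing M B with
  | _ k ih =>
  rcases (board \ (M ∪ B)).eq_empty_or_nonempty with hfull | ⟨x, hx⟩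
  · exact .final M B hfull ⟨A, hA, hAM⟩
  · refine .turn M B {x} ⟨x, hx⟩ (isLegalClaim_singleton hx) fun D _ => ?_
    refine ih _ ?_ (hAM.trans Finset.subset_union_left) rfl
    have hsub : M ∪ B ⊆ M ∪ {x} ∪ (B ∪ D) :=
      Finset.union_subset_union Finset.subset_union_left Finset.subset_union_left
    rw [← hk]
    exact Finset.card_lt_card <| (Finset.ssubset_iff_of_subset
      (Finset.sdiff_subset_sdiff subset_rfl hsub)).mpr ⟨x, hx, by simp⟩

theorem MakerWinsFrom.of_invariant {I : Finset α → Prop} {T : ℕ}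
    (hwin : ∀ M, I M → M.card = T → ∃ A ∈ H, A ⊆ M)
    (hstep : ∀ M B, I M → M.card < T → B.card ≤ b * M.card →
      ∃ x ∈ board \ (M ∪ B), I (insert x M)) {M B : Finset α} (hM : I M) (hT : M.card ≤ T)
    (hB : B.card ≤ b * M.card) : MakerWinsFrom board H 1 b M B := by
  induction hk : T - M.card generalizing M B with
  | zero =>
    obtain ⟨A, hA, hAM⟩ := hwin M hM (by omega)
    exact .of_subset hA hAM
  | succ k ih =>
    obtain ⟨x, hx, hI⟩ := hstep M B hM (by omega) hB
    have hxM : x ∉ M := fun h => (Finset.mem_sdiff.mp hx).2 (Finset.mem_union_left _ h)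
    have hcard := Finset.card_insert_of_notMem hxM
    refine .turn M B {x} ⟨x, hx⟩ (isLegalClaim_singleton hx) fun D hD => ?_
    rw [Finset.union_comm, ← Finset.insert_eq]
    have hunion := Finset.card_union_le B D
    have hDb : D.card ≤ b := hD.2 ▸ min_le_left _ _
    exact ih hI (by omega) (by rw [hcard, mul_add, mul_one]; omega) (by omega)

end Game

section NonPlanarityGame

open SimpleGraph

theorem edgeSet_fromEdgeSet_of_subset_completeBoard {n : ℕ} {M : Finset (Sym2 (Fin n))}
    (hM : M ⊆ completeBoard n) : (fromEdgeSet (M : Set (Sym2 (Fin n)))).edgeSet = M := by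
  rw [edgeSet_fromEdgeSet, sdiff_eq_left, Set.disjoint_left]
  exact fun e he => not_isDiag_of_mem_edgeFinset (hM he)

theorem card_completeBoard (n : ℕ) : ((completeBoard n).card : ℝ) = n * (n - 1) / 2 := by
  rw [completeBoard, card_edgeFinset_top_eq_card_choose_two, Fintype.card_fin, Nat.cast_choose_two]

theorem not_isPlanar_of_le_egirth {V : Type*} [Finite V] [Nonempty V] {G : SimpleGraph V} {ε : ℝ}
    {r : ℕ} (hr : 32 < ε * r) (hG : (4 * r : ℕ) ≤ G.egirth)
    (hcard : (1 + ε) * Nat.card V ≤ G.edgeSet.ncard) : ¬ IsPlanar G := by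
  intro hplanar
  have hr0 : 0 < r := Nat.pos_of_ne_zero fun h => by simp [h] at hr; linarith
  have hV : (0 : ℝ) < Nat.card V := by exact_mod_cast Nat.card_pos
  have hle : (r : ℝ) * G.edgeSet.ncard ≤ (r + 32) * Nat.card V := by
    exact_mod_cast hplanar.mul_ncard_edgeSet_le hr0 hG
  have hmul : (r : ℝ) * ((1 + ε) * Nat.card V) ≤ r * G.edgeSet.ncard :=
    mul_le_mul_of_nonneg_left hcard r.cast_nonneg
  nlinarith

theorem claimed_add_forbidden_lt {ε n b m h Δ C : ℝ} (hε : 0 < ε) (hε' : ε ≤ 1 / 2) (hn : 0 < n)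
    (hm₀ : 0 ≤ m) (hh₀ : 0 ≤ h) (hb : b ≤ (1 / 2 - ε) * n) (hm : m ≤ (1 + ε) * n)
    (hh : h * Δ ≤ 2 * m) (hΔ : 16 ≤ ε * Δ) (hC : 4 * (C + 3) ≤ ε * n) :
    m + b * m + (h * n + n * C) < n * (n - 1) / 2 := by
  have hm' : m ≤ 3 / 2 * n := hm.trans (by gcongr; linarith)
  have hbm : b * m ≤ (1 / 2 - ε) * n * ((1 + ε) * n) := by gcongr
  have hhε : h ≤ ε * n / 4 := by
    have h16 : h * 16 ≤ h * (ε * Δ) := by gcongr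
    have h2m : ε * (h * Δ) ≤ ε * (3 * n) := mul_le_mul_of_nonneg_left (by linarith) hε.le
    linarith [mul_pos hε hn]
  have hhn : h * n ≤ ε * n / 4 * n := by gcongr
  have hnC : n * C ≤ n * (ε * n / 4 - 3) := by gcongr; linarith
  have : 0 ≤ (ε * n) ^ 2 := by positivity
  linarith

theorem exists_isSparse_insert {n b Δ g : ℕ} {ε : ℝ} (hε : 0 < ε) (hε' : ε ≤ 1 / 2)
    (hb : b ≤ (1 / 2 - ε) * n) (hΔ : 16 ≤ ε * Δ) (hg : 4 * ((Δ + 1) ^ g + 3) ≤ ε * n)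
    {M B : Finset (Sym2 (Fin n))} (hM : M ⊆ completeBoard n)
    (hsparse : IsSparse Δ g (fromEdgeSet (M : Set (Sym2 (Fin n))))) (hMn : M.card ≤ (1 + ε) * n)
    (hB : B.card ≤ b * M.card) :
    ∃ e ∈ completeBoard n \ (M ∪ B),
      IsSparse Δ g (fromEdgeSet ((insert e M : Finset (Sym2 (Fin n))) : Set (Sym2 (Fin n)))) := by
  have hdeg := ncard_le_ncard_neighborSet_mul_le (G := fromEdgeSet (M : Set (Sym2 (Fin n)))) Δ
  rw [edgeSet_fromEdgeSet_of_subset_completeBoard hM, Set.ncard_coe_finset] at hdeg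
  have hn : (0 : ℝ) < n := pos_of_mul_pos_right (hg.trans_lt' (by positivity)) hε.le
  have hlt := claimed_add_forbidden_lt hε hε' hn M.card.cast_nonneg (Nat.cast_nonneg _) hb hMn
    (by exact_mod_cast hdeg) hΔ hg
  rw [← card_completeBoard] at hlt
  norm_cast at hlt
  have hunion := Finset.card_union_le M B
  have hfree := Finset.le_card_sdiff (M ∪ B) (completeBoard n)
  obtain ⟨x, y, hxy, hsparse'⟩ := hsparse.exists_isSparse_sup_edge
    (F := completeBoard n \ (M ∪ B)) (by rw [Nat.card_fin]; omega)
  refine ⟨s(x, y), hxy, ?_⟩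
  rwa [edge, ← fromEdgeSet_union, Set.union_comm, ← Set.insert_eq, ← Finset.coe_insert] at hsparse'

end NonPlanarityGame

theorem mainTheorem8 (ε : ℝ) (hε : 0 < ε) :
    ∃ N : ℕ, ∀ n : ℕ, N ≤ n → ∀ b : ℕ, 0 < b → (b : ℝ) ≤ (1 / 2 - ε) * n →
      MakerWins (completeBoard n) (nonPlanarSets n) 1 b := by
  obtain ⟨r, hr⟩ := exists_nat_gt (32 / ε)
  obtain ⟨Δ, hΔ⟩ := exists_nat_ge (16 / ε)
  obtain ⟨N, hN⟩ := exists_nat_ge (4 * (((Δ : ℝ) + 1) ^ (4 * r) + 3) / ε)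
  rw [div_lt_iff₀' hε] at hr
  rw [div_le_iff₀' hε] at hΔ hN
  refine ⟨N, fun n hNn b hb₀ hb => ?_⟩
  have hlarge : 4 * (((Δ : ℝ) + 1) ^ (4 * r) + 3) ≤ ε * n := hN.trans (by gcongr)
  have hn : (0 : ℝ) < n := pos_of_mul_pos_right (hlarge.trans_lt' (by positivity)) hε.le
  have hε' : 0 < 1 / 2 - ε := pos_of_mul_pos_left ((Nat.cast_pos.mpr hb₀).trans_le hb) hn.le
  have : Nonempty (Fin n) := ⟨⟨0, by exact_mod_cast hn⟩⟩
  refine MakerWinsFrom.of_invariant (T := ⌈(1 + ε) * n⌉₊)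
    (I := fun M => M ⊆ completeBoard n ∧
      IsSparse Δ (4 * r) (SimpleGraph.fromEdgeSet (M : Set (Sym2 (Fin n)))))
    ?_ ?_ ⟨Finset.empty_subset _, ?_⟩ (by simp) (by simp)
  · rintro M ⟨hM, hsparse⟩ hcard
    refine ⟨M, ⟨hM, not_isPlanar_of_le_egirth hr hsparse.2 ?_⟩, subset_rfl⟩
    rw [edgeSet_fromEdgeSet_of_subset_completeBoard hM, Set.ncard_coe_finset, hcard, Nat.card_fin]
    exact Nat.le_ceil _
  · rintro M B ⟨hM, hsparse⟩ hcard hB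
    obtain ⟨e, he, hins⟩ := exists_isSparse_insert hε (by linarith) hb hΔ hlarge hM hsparse
      (Nat.lt_ceil.mp hcard).le hB
    exact ⟨e, he, Finset.insert_subset (Finset.mem_sdiff.mp he).1 hM, hins⟩
  · simpa using isSparse_bot Δ (4 * r)
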